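/- Let $M$ be a compact metric space and $X=\{X^t\}_{t\in\mathbb R}$ a (continuous) flow on $M$. For $A\subset M$ let $\mathcal H(A)$ be the set of all families $\alpha=(\alpha(a))_{a\in A}$ of homeomorphisms of $\mathbb R$ with $\alpha(a)(0)=0$ for all $a\in A$, such that $\alpha(x_\alpha)=\mathrm{id}_{\mathbb R}$ for some $x_\alpha\in A$ and $a\mapsto\alpha(a)(t)$ is continuous on $A$ for every $t\in\mathbb R$; put $\mathcal X^t_\alpha(A)=\{X^{\alpha(a)(t)}(a):a\in A\}$. The flow $X$ is *$N$-expansive* if for every $\varepsilon>0$ there is $\delta>0$ such that, whenever $A\subset M$ and $\alpha\in\mathcal H(A)$ satisfy $\operatorname{diam}\mathcal X^t_\alpha(A)<\delta$ for all $t\in\mathbb R$, there is $B\subset A$ with at most $N$ points and $A\subset X^{(-\varepsilon,\varepsilon)}(B)$. It is *cw-expansive* if for every $\varepsilon>0$ there is $\delta>0$ such that, whenever $A\subset M$ is compact and connected and $\alpha\in\mathcal H(A)$ satisfies $\operatorname{diam}\mathcal X^t_\alpha(A)<\delta$ for all $t\in\mathbb R$, one has $A\subset X^{(-\varepsilon,\varepsilon)}(x_\alpha)$.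 It is *expansive* (Bowen–Walters) if for every $\varepsilon>0$ there is $\delta>0$ such that, whenever $x,y\in M$ and a continuous $s:\mathbb R\to\mathbb R$ with $s(0)=0$ satisfy $d(X^t(x),X^{s(t)}(y))<\delta$ for all $t\in\mathbb R$, one has $y\in X^{(-\varepsilon,\varepsilon)}(x)$. A homeomorphism $f$ of a compact metric space $Y$ is *$N$-expansive* if there is $\delta>0$ such that for every $x\in Y$ the set $\{y: d(f^n(x),f^n(y))\le\delta\ \forall n\in\mathbb Z\}$ has at most $N$ points, *expansive* if for some $\delta>0$ this set is always $\{x\}$, and *cw-expansive* if there is $\delta>0$ such that every compact connected $A\subset Y$ with $\operatorname{diam} f^n(A)<\delta$ for all $n\in\mathbb Z$ has at most one point. The *suspension* of $f$ is the flow induced by $(y,s)\mapsto(y,s+t)$ on the quotient of $Y\times\mathbb R$ by the equivalence relation generated by $(y,s+1)\sim(f(y),s)$. **Theorem.** There is a cw-expansive flow on a compact metric space that is not $N$-expansive for any $N\ge1$. Moreover, for each $N\ge2$ there are flows $X$ and $Y$ on compact metric spaces $M$ and $L$ such that 1. $X$ is $N$-expansive but not expansive; 2. $Y$ is $(N+1)$-expansive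 but not $N$-expansive. All these flows can be taken to be suspensions of homeomorphisms of compact metric spaces that have the corresponding property: respectively, a cw-expansive homeomorphism that is not $N$-expansive for any $N\ge1$, an $N$-expansive homeomorphism that is not expansive, and an $(N+1)$-expansive homeomorphism that is not $N$-expansive. -/

import Mathlib

namespace CWFlow

/-! ### Flows on compact metric spaces

A flow on `M` is a continuous action `X : Flow ℝ M` of the additive group of real numbers;
`X t` is the time-`t` homeomorphism. -/

section Flows

variable {M : Type*} [MetricSpace M] [CompactSpace M]

/-- The open orbit segment `X^{(-ε,ε)}(x)`. -/
def orbitSegment (X : Flow ℝ M) (ε : ℝ) (x : M) : Set M :=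
  (fun t : ℝ => X t x) '' Set.Ioo (-ε) ε

/-- `α` belongs to `H(A)`, with base point `x`: each `α a` is a homeomorphism of `ℝ` fixing the
origin, `α x` is the identity, and `a ↦ α a t` is continuous on `A` for each fixed `t`. -/
def IsReparametrization (A : Set M) (α : A → ℝ ≃ₜ ℝ) (x : A) : Prop :=
  (∀ a, α a 0 = 0) ∧ α x = Homeomorph.refl ℝ ∧ ∀ t : ℝ, Continuous fun a : A => α a t

/-- The set `{X^{α(a)(t)}(a) : a ∈ A}`. -/
def reparamImage (X : Flow ℝ M) (A : Set M) (α : A → ℝ ≃ₜ ℝ) (t : ℝ) : Set M :=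
  Set.range fun a : A => X (α a t) (a : M)

/-- `N`-expansive flows. -/
def NExpansive (N : ℕ) (X : Flow ℝ M) : Prop :=
  ∀ ε > 0, ∃ δ > 0, ∀ (A : Set M) (α : A → ℝ ≃ₜ ℝ),
    (∃ x : A, IsReparametrization A α x) →
    (∀ t : ℝ, Metric.diam (reparamImage X A α t) < δ) →
    ∃ B ⊆ A, B.encard ≤ N ∧ A ⊆ ⋃ b ∈ B, orbitSegment X ε b

/-- Continuum-wise expansive flows. A continuum is a (nonempty) compact connected set. -/
def CWExpansive (X : Flow ℝ M) : Prop :=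
  ∀ ε > 0, ∃ δ > 0, ∀ A : Set M, IsCompact A → IsConnected A →
    ∀ (α : A → ℝ ≃ₜ ℝ) (x : A), IsReparametrization A α x →
    (∀ t : ℝ, Metric.diam (reparamImage X A α t) < δ) →
    A ⊆ orbitSegment X ε (x : M)

/-- Expansive flows, in the sense of Bowen and Walters. -/
def Expansive (X : Flow ℝ M) : Prop :=
  ∀ ε > 0, ∃ δ > 0, ∀ (x y : M) (s : ℝ → ℝ), Continuous s → s 0 = 0 →
    (∀ t : ℝ, dist (X t x) (X (s t) y) < δ) →
    y ∈ orbitSegment X ε x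

end Flows

/-! ### Homeomorphisms of compact metric spaces -/

section Homeomorphisms

variable {Y : Type*} [MetricSpace Y] [CompactSpace Y]

/-- `N`-expansive homeomorphisms: some dynamical ball radius `δ > 0` such that every dynamical
ball has at most `N` points. -/
def NExpansiveHomeo (N : ℕ) (f : Y ≃ₜ Y) : Prop :=
  ∃ δ > 0, ∀ x : Y, {y : Y | ∀ n : ℤ, dist ((f ^ n) x) ((f ^ n) y) ≤ δ}.encard ≤ N

/-- Continuum-wise expansive homeomorphisms. -/
def CWExpansiveHomeo (f : Y ≃ₜ Y) : Prop :=
  ∃ δ > 0, ∀ A : Set Y, IsCompact A → IsConnected A →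
    (∀ n : ℤ, Metric.diam ((f ^ n) '' A) < δ) → A.Subsingleton

/-- Expansive homeomorphisms. -/
def ExpansiveHomeo (f : Y ≃ₜ Y) : Prop :=
  ∃ δ > 0, ∀ x y : Y, (∀ n : ℤ, dist ((f ^ n) x) ((f ^ n) y) ≤ δ) → x = y

end Homeomorphisms

/-! ### Suspensions -/

section Suspension

variable {Y : Type*} [TopologicalSpace Y]

/-- The equivalence relation on `Y × ℝ` generated by `(y, s + 1) ∼ (f y, s)`. -/
def suspensionSetoid (f : Y ≃ₜ Y) : Setoid (Y × ℝ) where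
  r p q := ∃ n : ℤ, q = ((f ^ n) p.1, p.2 - n)
  iseqv :=
    { refl := fun p => ⟨0, by simp⟩
      symm := by
        rintro p q ⟨n, rfl⟩
        refine ⟨-n, Prod.ext ?_ ?_⟩
        · simp [← Homeomorph.mul_apply]
        · simp
      trans := by
        rintro p q r ⟨n, rfl⟩ ⟨m, rfl⟩
        refine ⟨m + n, Prod.ext ?_ ?_⟩
        · simp [← Homeomorph.mul_apply, zpow_add]
        · push_cast
          ring }

/-- The suspension space of `f` (under the constant function `1`), i.e. `Y × [0,1]` with
`(y, 1)` and `(f y, 0)` identified, written as the quotient of `Y × ℝ` by the relation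
generated by `(y, s + 1) ∼ (f y, s)`, with the quotient topology. -/
def SuspensionSpace (f : Y ≃ₜ Y) : Type _ := Quotient (suspensionSetoid f)

instance (f : Y ≃ₜ Y) : TopologicalSpace (SuspensionSpace f) :=
  inferInstanceAs (TopologicalSpace (Quotient (suspensionSetoid f)))

/-- The projection `Y × ℝ → SuspensionSpace f`. -/
def suspensionMk (f : Y ≃ₜ Y) (p : Y × ℝ) : SuspensionSpace f :=
  Quotient.mk (suspensionSetoid f) p

theorem isOpenQuotientMap_suspensionMk (f : Y ≃ₜ Y) : IsOpenQuotientMap (suspensionMk f) := by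
  refine ⟨Quotient.mk_surjective, continuous_quotient_mk', fun U hU => ?_⟩
  have hq : Topology.IsQuotientMap (suspensionMk f) := isQuotientMap_quotient_mk'
  rw [← hq.isOpen_preimage]
  have : suspensionMk f ⁻¹' (suspensionMk f '' U) =
      ⋃ n : ℤ, (fun p : Y × ℝ => ((f ^ n) p.1, p.2 - (n : ℝ))) ⁻¹' U := by
    ext p
    simp only [Set.mem_preimage, Set.mem_image, Set.mem_iUnion]
    constructor
    · rintro ⟨q, hqU, hqp⟩
      obtain ⟨n, rfl⟩ := Quotient.exact hqp.symm
      exact ⟨n, hqU⟩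
    · rintro ⟨n, hn⟩
      exact ⟨_, hn, (Quotient.sound (s := suspensionSetoid f) ⟨n, rfl⟩).symm⟩
  rw [this]
  refine isOpen_iUnion fun n => hU.preimage ?_
  exact ((f ^ n).continuous.comp continuous_fst).prodMk (continuous_snd.sub continuous_const)

/-- The suspension flow of `f`: `X^t [y, s] = [y, s + t]`. -/
def suspensionFlow (f : Y ≃ₜ Y) : Flow ℝ (SuspensionSpace f) where
  toFun t := Quotient.map' (s₁ := suspensionSetoid f) (s₂ := suspensionSetoid f)
    (fun p => (p.1, p.2 + t)) (by
      rintro p q ⟨n, rfl⟩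
      exact ⟨n, Prod.ext rfl (by simp only; ring)⟩)
  cont' := by
    have h := (IsOpenQuotientMap.id (X := ℝ)).prodMap (isOpenQuotientMap_suspensionMk f)
    rw [h.isQuotientMap.continuous_iff]
    exact (isOpenQuotientMap_suspensionMk f).continuous.comp
      (f := fun q : ℝ × (Y × ℝ) => (q.2.1, q.2.2 + q.1)) (by fun_prop)
  map_add' := by
    rintro t₁ t₂ ⟨p⟩
    exact congrArg (suspensionMk f) (Prod.ext rfl (by simp only; ring))
  map_zero' := by
    rintro ⟨p⟩
    exact congrArg (suspensionMk f) (Prod.ext rfl (add_zero _))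

/-- The flow `X` on `M` is the suspension of `f`: the topological space `M` is identified with
the suspension space of `f` so that `X` becomes the suspension flow (with the same time). -/
def IsSuspension {M : Type*} [TopologicalSpace M] (X : Flow ℝ M) (f : Y ≃ₜ Y) : Prop :=
  ∃ h : M ≃ₜ SuspensionSpace f, ∀ (t : ℝ) (x : M), h (X t x) = suspensionFlow f t (h x)

end Suspension

end CWFlow

open Set Metric Topology

namespace CWFlow

/-! ### The topology of suspensions -/

section SuspensionTopology

variable {Y : Type*}

/-! Expansivity properties pass between a homeomorphism and its suspension, so it suffices to build
homeomorphisms of compact metric spaces.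

From `f` to the flow: if a reparametrized orbit shadows another, comparing time coordinates modulo 1
keeps the two times close, since a continuous real function cannot jump by an integer. At integer
times the fibre coordinates are then close too, so the shadowing point lies, up to a short time, in
a small dynamical ball of `f` (`exists_lift_of_shadowing`). From the flow to `f`: a small dynamical
ball, placed in the slice `Y × {0}`, is a set whose flow images stay small under identity
reparametrizations, and a short orbit segment meets the slice at most once.

The homeomorphisms come from an expansive `g` with pairwise disjoint closed invariant sets `O k`,
nonempty for arbitrarily large `k`. Above each `O k` lie `c k` parallel copies at height at most `1
/ (k + 1)`. Expansivity of `g` confines small dynamical balls to vertical fibres, which have at most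
`c k + 1` points; heights are preserved by the dynamics and shrink with `k`, so full fibres occur in
arbitrarily small dynamical balls. Constant `c = N` gives `(N + 1)`- but not `N`-expansivity. With
`c = id` no `N` works, but all fibres are finite, so small continua are points. For `g` one takes
the shift on the dyadic solenoid, with the sets of points whose coordinates have a fixed additive
order. -/

theorem suspensionMk_eq_iff [TopologicalSpace Y] (f : Y ≃ₜ Y) (p q : Y × ℝ) :
    suspensionMk f p = suspensionMk f q ↔ ∃ n : ℤ, q = ((f ^ n) p.1, p.2 - n) :=
  Quotient.eq (r := suspensionSetoid f)

theorem suspensionMk_add_int [TopologicalSpace Y] (f : Y ≃ₜ Y) (y : Y) (s : ℝ) (n : ℤ) :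
    suspensionMk f (y, s + n) = suspensionMk f ((f ^ n) y, s) :=
  (suspensionMk_eq_iff f _ _).2 ⟨n, by simp⟩

instance compactSpace_suspensionSpace [TopologicalSpace Y] [CompactSpace Y] (f : Y ≃ₜ Y) :
    CompactSpace (SuspensionSpace f) := by
  refine ⟨?_⟩
  have hK : IsCompact ((univ : Set Y) ×ˢ Icc (0 : ℝ) 1) := isCompact_univ.prod isCompact_Icc
  convert hK.image (isOpenQuotientMap_suspensionMk f).continuous
  refine (eq_univ_of_forall fun x => ?_).symm
  obtain ⟨⟨y, s⟩, rfl⟩ := (isOpenQuotientMap_suspensionMk f).surjective x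
  refine ⟨((f ^ ⌊s⌋) y, Int.fract s),
    ⟨mem_univ _, Int.fract_nonneg s, (Int.fract_lt_one s).le⟩, ?_⟩
  rw [← suspensionMk_add_int, Int.fract_add_floor]

/-- The difference of the time coordinates of two equivalent points is the integer `n`, so the
relation is a locally finite union of closed graphs, hence closed; the quotient map is open. -/
instance t2Space_suspensionSpace [TopologicalSpace Y] [T2Space Y] (f : Y ≃ₜ Y) :
    T2Space (SuspensionSpace f) := by
  rw [t2Space_iff_of_isOpenQuotientMap (isOpenQuotientMap_suspensionMk f)]
  have hU : {q : (Y × ℝ) × (Y × ℝ) | suspensionMk f q.1 = suspensionMk f q.2} =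
      ⋃ n : ℤ, {q : (Y × ℝ) × (Y × ℝ) | q.2 = ((f ^ n) q.1.1, q.1.2 - (n : ℝ))} := by
    ext q
    simp [suspensionMk_eq_iff]
  rw [hU]
  refine LocallyFinite.isClosed_iUnion (fun q => ?_) fun n => ?_
  · set g : (Y × ℝ) × (Y × ℝ) → ℝ := fun q => q.1.2 - q.2.2
    have hg : Continuous g := by fun_prop
    refine ⟨g ⁻¹' Icc (g q - 1) (g q + 1),
      hg.continuousAt.preimage_mem_nhds (Icc_mem_nhds (by linarith) (by linarith)),
      (finite_Icc ⌈g q - 1⌉ ⌊g q + 1⌋).subset ?_⟩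
    rintro n ⟨r, hr, hr'⟩
    have hn : g r = n := by
      simp only [mem_ofPred_eq] at hr
      simp [g, hr]
    rw [mem_preimage, hn] at hr'
    exact ⟨Int.ceil_le.2 hr'.1, Int.le_floor.2 hr'.2⟩
  · refine isClosed_eq continuous_snd (Continuous.prodMk ?_ (by fun_prop))
    exact (f ^ n).continuous.comp (by fun_prop)

instance secondCountableTopology_suspensionSpace [TopologicalSpace Y]
    [SecondCountableTopology Y] (f : Y ≃ₜ Y) :
    SecondCountableTopology (SuspensionSpace f) :=
  (isOpenQuotientMap_suspensionMk f).isQuotientMap.secondCountableTopology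
    (isOpenQuotientMap_suspensionMk f).isOpenMap

instance metrizableSpace_suspensionSpace [MetricSpace Y] [CompactSpace Y] (f : Y ≃ₜ Y) :
    TopologicalSpace.MetrizableSpace (SuspensionSpace f) :=
  TopologicalSpace.metrizableSpace_of_t3_secondCountable _

/-- Every homeomorphism of a compact metric space has a suspension on a compact metric space. -/
theorem exists_isSuspension {Y : Type} [MetricSpace Y] [CompactSpace Y] (f : Y ≃ₜ Y) :
    ∃ (M : Type) (_ : MetricSpace M) (_ : CompactSpace M) (X : Flow ℝ M), IsSuspension X f := by
  let m : MetricSpace (SuspensionSpace f) := TopologicalSpace.metrizableSpaceMetric _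
  exact ⟨SuspensionSpace f, m, compactSpace_suspensionSpace f, suspensionFlow f,
    Homeomorph.refl _, fun _ _ => rfl⟩

end SuspensionTopology

/-! ### Flow boxes of a suspension -/

/-- `π` presents the flow `X` as the quotient of the translation flow on `Y × ℝ` by the relation
`(y, s + 1) ∼ (f y, s)`. -/
structure IsSuspensionProj {Y M : Type*} [TopologicalSpace Y] [TopologicalSpace M]
    (X : Flow ℝ M) (f : Y ≃ₜ Y) (π : Y × ℝ → M) : Prop where
  isOpenQuotientMap : IsOpenQuotientMap π
  eq_iff : ∀ p q, π p = π q ↔ ∃ n : ℤ, q = ((f ^ n) p.1, p.2 - n)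
  flow : ∀ (t : ℝ) (y : Y) (s : ℝ), X t (π (y, s)) = π (y, s + t)

theorem IsSuspension.exists_proj {Y M : Type*} [TopologicalSpace Y] [TopologicalSpace M]
    {X : Flow ℝ M} {f : Y ≃ₜ Y} (h : IsSuspension X f) :
    ∃ π : Y × ℝ → M, IsSuspensionProj X f π := by
  obtain ⟨e, he⟩ := h
  refine ⟨e.symm ∘ suspensionMk f,
    e.symm.isOpenQuotientMap.comp (isOpenQuotientMap_suspensionMk f), fun p q => ?_,
    fun t y s => ?_⟩
  · simp [← suspensionMk_eq_iff f p q]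
  · apply e.injective
    simp only [he, Function.comp_apply, Homeomorph.apply_symm_apply]
    rfl

namespace IsSuspensionProj

section Top

variable {Y M : Type*} [TopologicalSpace Y] [TopologicalSpace M] {X : Flow ℝ M} {f : Y ≃ₜ Y}
  {π : Y × ℝ → M}

theorem continuous (h : IsSuspensionProj X f π) : Continuous π :=
  h.isOpenQuotientMap.continuous

theorem surjective (h : IsSuspensionProj X f π) : Function.Surjective π :=
  h.isOpenQuotientMap.surjective

theorem add_int (h : IsSuspensionProj X f π) (y : Y) (s : ℝ) (n : ℤ) :
    π (y, s + n) = π ((f ^ n) y, s) :=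
  (h.eq_iff _ _).2 ⟨n, by simp⟩

/-- Two lifts whose time coordinates differ by less than `1` coincide. -/
theorem eq_of_eq (h : IsSuspensionProj X f π) {y y' : Y} {s s' : ℝ} (hs : |s - s'| < 1)
    (heq : π (y, s) = π (y', s')) : y = y' ∧ s = s' := by
  obtain ⟨n, hn⟩ := (h.eq_iff _ _).1 heq
  obtain ⟨h1, h2⟩ := Prod.ext_iff.1 hn
  simp only at h1 h2
  have hn0 : n = 0 := by
    rw [← Int.abs_lt_one_iff]
    have : |(n : ℝ)| < 1 := by
      rwa [show (n : ℝ) = s - s' by linarith]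
    exact_mod_cast this
  subst hn0
  exact ⟨by simpa using h1.symm, by simpa using h2.symm⟩

theorem exists_circle_proj (h : IsSuspensionProj X f π) :
    ∃ θ : M → UnitAddCircle, Continuous θ ∧ ∀ y s, θ (π (y, s)) = (s : UnitAddCircle) := by
  have hθ : ∀ p q : Y × ℝ, π p = π q → (p.2 : UnitAddCircle) = (q.2 : UnitAddCircle) := by
    intro p q hpq
    obtain ⟨n, rfl⟩ := (h.eq_iff _ _).1 hpq
    simp only [AddCircle.coe_sub]
    rw [eq_comm, sub_eq_self, AddCircle.coe_eq_zero_iff]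
    exact ⟨n, by simp⟩
  have hcomp : (fun m => ((Function.surjInv h.surjective m).2 : UnitAddCircle)) ∘ π =
      fun p => (p.2 : UnitAddCircle) :=
    funext fun p => hθ _ _ (Function.surjInv_eq h.surjective _)
  refine ⟨fun m => ((Function.surjInv h.surjective m).2 : UnitAddCircle), ?_,
    fun y s => congrFun hcomp (y, s)⟩
  rw [← h.isOpenQuotientMap.continuous_comp_iff, hcomp]
  exact (AddCircle.continuous_mk' 1).comp continuous_snd

end Top

/-- To leave the interval, `|g|` would have to take the value `ε ≤ 1 / 2`, and there the circle norm
of `g t` equals `ε`. -/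
theorem abs_lt_of_norm_coe_lt {g : ℝ → ℝ} (hg : Continuous g) {ε : ℝ} (hε : ε ≤ 1 / 2)
    (hlt : ∀ t, ‖(g t : UnitAddCircle)‖ < ε) (h0 : |g 0| < ε) (t : ℝ) : |g t| < ε := by
  have hne : ∀ t, |g t| ≠ ε := by
    intro t ht
    have := (AddCircle.norm_coe_eq_abs_iff (1 : ℝ) (x := g t) one_ne_zero).2
      (by rw [ht]; simpa using hε)
    exact (hlt t).ne (this.trans ht)
  by_contra hcon
  have hc : ContinuousOn (fun t => |g t|) univ := by fun_prop
  obtain ⟨t', -, ht'⟩ := isPreconnected_univ.intermediate_value (mem_univ 0) (mem_univ t) hc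
    ⟨h0.le, not_lt.1 hcon⟩
  exact hne t' ht'

section Metric

variable {Y M : Type*} [MetricSpace Y] [MetricSpace M]
  {X : Flow ℝ M} {f : Y ≃ₜ Y} {π : Y × ℝ → M}

/-- Compactness: `π` separates points whose times differ by less than 1, so the distance of
projections has a positive minimum over pairs with `η ≤ dist u v` and `|r| ≤ 1 / 4`. -/
theorem dist_lt_of_dist_proj_lt [CompactSpace Y] (h : IsSuspensionProj X f π) {η : ℝ} (hη : 0 < η) :
    ∃ δ > 0, ∀ (u v : Y) (r : ℝ), |r| ≤ 1 / 4 → dist (π (u, 0)) (π (v, r)) < δ →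
      dist u v < η := by
  have hπ := h.continuous
  set K : Set (Y × Y × ℝ) := {q | η ≤ dist q.1 q.2.1 ∧ |q.2.2| ≤ 1 / 4}
  have hK : IsCompact K := by
    have hc : IsCompact ((univ : Set Y) ×ˢ (univ : Set Y) ×ˢ Icc (-(1 / 4) : ℝ) (1 / 4)) :=
      isCompact_univ.prod (isCompact_univ.prod isCompact_Icc)
    refine hc.of_isClosed_subset ?_ fun q hq => ⟨mem_univ _, mem_univ _, abs_le.1 hq.2⟩
    have h1 : IsClosed {q : Y × Y × ℝ | η ≤ dist q.1 q.2.1} :=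
      isClosed_le (by fun_prop) (by fun_prop)
    have h2 : IsClosed {q : Y × Y × ℝ | |q.2.2| ≤ 1 / 4} :=
      isClosed_le (by fun_prop) (by fun_prop)
    exact h1.inter h2
  have hpos : ∀ q ∈ K, 0 < dist (π (q.1, 0)) (π (q.2.1, q.2.2)) := by
    rintro ⟨u, v, r⟩ ⟨h1, h2⟩
    refine dist_pos.2 fun heq => ?_
    dsimp only at h1 h2 heq
    obtain ⟨rfl, -⟩ := h.eq_of_eq (by rw [zero_sub, abs_neg]; linarith) heq
    rw [dist_self] at h1
    linarith
  rcases K.eq_empty_or_nonempty with hE | hne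
  · refine ⟨1, one_pos, fun u v r hr _ => lt_of_not_ge fun hge => ?_⟩
    have : (u, v, r) ∈ K := ⟨hge, hr⟩
    rw [hE] at this
    exact this
  · obtain ⟨q, hq, hmin⟩ := hK.exists_isMinOn hne
      (f := fun q : Y × Y × ℝ => dist (π (q.1, 0)) (π (q.2.1, q.2.2))) (by fun_prop)
    refine ⟨_, hpos q hq, fun u v r hr hd => lt_of_not_ge fun hge => ?_⟩
    exact absurd (hmin (show (u, v, r) ∈ K from ⟨hge, hr⟩)) (not_le.2 hd)

/-- If a reparametrized orbit of `X` stays close to the orbit of `π (y, s)`, then its initial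
point lies, up to a short time, in a small dynamical ball of `f` centred at `y`. -/
theorem exists_lift_of_shadowing [CompactSpace Y] [CompactSpace M]
    (h : IsSuspensionProj X f π) {ε η : ℝ} (hε : 0 < ε) (hη : 0 < η) :
    ∃ δ > 0, ∀ (y : Y) (s : ℝ) (a : M) (φ : ℝ → ℝ), Continuous φ → φ 0 = 0 →
      (∀ t, dist (X t (π (y, s))) (X (φ t) a) < δ) →
      ∃ (y' : Y) (s' : ℝ), a = π (y', s') ∧ |s - s'| < ε ∧
        ∀ n : ℤ, dist ((f ^ n) y) ((f ^ n) y') < η := by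
  obtain ⟨θ, hθc, hθ⟩ := h.exists_circle_proj
  obtain ⟨δ₁, hδ₁, H₁⟩ := h.dist_lt_of_dist_proj_lt hη
  set ε' := min ε (1 / 4) with hε'
  have hε'0 : 0 < ε' := lt_min hε (by norm_num)
  have hε'1 : ε' ≤ 1 / 4 := min_le_right _ _
  obtain ⟨δ₂, hδ₂, H₂⟩ := Metric.uniformContinuous_iff.1
    (CompactSpace.uniformContinuous_of_continuous hθc) ε' hε'0
  refine ⟨min δ₁ δ₂, lt_min hδ₁ hδ₂, fun y s a φ hφ hφ0 hd => ?_⟩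
  obtain ⟨⟨z, r⟩, rfl⟩ := h.surjective a
  have hcirc : ∀ t, ‖((s + t - (r + φ t) : ℝ) : UnitAddCircle)‖ < ε' := by
    intro t
    have := H₂ ((hd t).trans_le (min_le_right _ _))
    rwa [h.flow, h.flow, hθ, hθ, dist_eq_norm, ← AddCircle.coe_sub] at this
  have hc0 := hcirc 0
  rw [hφ0, add_zero, add_zero, UnitAddCircle.norm_eq] at hc0
  -- Among the lifts of `a`, the one with time `r + k` is closest in time to `s`.
  set k := round (s - r)
  have hz : π ((f ^ (-k)) z, r + k) = π (z, r) := by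
    rw [h.add_int, ← Homeomorph.mul_apply, ← zpow_add]
    simp
  have hs : ∀ t, |s + t - (r + k + φ t)| < ε' := by
    refine fun t => abs_lt_of_norm_coe_lt (g := fun t => s + t - (r + k + φ t)) (by fun_prop)
      (by linarith) (fun t => ?_) ?_ t
    · have hk : ((k : ℝ) : UnitAddCircle) = 0 := by
        rw [AddCircle.coe_eq_zero_iff]
        exact ⟨k, by simp⟩
      have : s + t - (r + k + φ t) = (s + t - (r + φ t)) - k := by ring
      rw [this, AddCircle.coe_sub, hk, sub_zero]
      exact hcirc t
    · simp only [hφ0, add_zero]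
      rwa [← sub_sub]
  refine ⟨(f ^ (-k)) z, r + k, hz.symm, ?_, fun n => ?_⟩
  · have := hs 0
    rw [hφ0, add_zero, add_zero] at this
    exact this.trans_le (min_le_left _ _)
  -- At time `n - s` the first orbit passes through `π ((f ^ n) y, 0)`, while the second is over `(f
  -- ^ n) y'` at a time of absolute value less than `1 / 4`.
  · have hn := hs (n - s)
    have hdn := (hd (n - s)).trans_le (min_le_left _ _)
    rw [← hz, h.flow, h.flow, show s + ((n : ℝ) - s) = 0 + n by ring, h.add_int,
      show r + k + φ (n - s) = (r + k + φ (n - s) - n) + n by ring, h.add_int] at hdn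
    refine H₁ _ _ _ ?_ hdn
    rw [abs_sub_comm, show s + ((n : ℝ) - s) = n by ring] at hn
    linarith

theorem mem_orbitSegment (h : IsSuspensionProj X f π) {y : Y} {s s' ε : ℝ} (hs : |s - s'| < ε) :
    π (y, s) ∈ orbitSegment X ε (π (y, s')) := by
  refine ⟨s - s', abs_lt.1 hs, ?_⟩
  simp only [h.flow]
  congr 2
  ring

/-- Close points of `Y` have close flow lines, uniformly as long as their `f`-orbits are close. -/
theorem exists_dist_flow_lt [CompactSpace Y] (h : IsSuspensionProj X f π) {δ : ℝ} (hδ : 0 < δ) :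
    ∃ η > 0, ∀ u v : Y, (∀ n : ℤ, dist ((f ^ n) u) ((f ^ n) v) ≤ η) →
      ∀ t, dist (X t (π (u, 0))) (X t (π (v, 0))) < δ := by
  have hK : IsCompact ((univ : Set Y) ×ˢ Icc (0 : ℝ) 1) := isCompact_univ.prod isCompact_Icc
  obtain ⟨η, hη, H⟩ := Metric.uniformContinuousOn_iff.1
    (hK.uniformContinuousOn_of_continuous h.continuous.continuousOn) δ hδ
  refine ⟨η / 2, half_pos hη, fun u v huv t => ?_⟩
  have hfract : Int.fract t ∈ Icc (0 : ℝ) 1 := ⟨Int.fract_nonneg t, (Int.fract_lt_one t).le⟩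
  rw [h.flow, h.flow, zero_add, ← Int.fract_add_floor t, h.add_int, h.add_int]
  refine H _ ⟨mem_univ _, hfract⟩ _ ⟨mem_univ _, hfract⟩ ?_
  rw [Prod.dist_eq, dist_self, max_eq_left dist_nonneg]
  exact (huv _).trans_lt (half_lt_self hη)

end Metric

end IsSuspensionProj

end CWFlow

namespace CWFlow

/-! ### Expansivity of a homeomorphism and of its suspension -/

section Transfer

variable {Y M : Type*} [MetricSpace Y] [MetricSpace M] {X : Flow ℝ M} {f : Y ≃ₜ Y}

theorem dist_lt_of_diam_reparamImage_lt [CompactSpace M] {A : Set M} {α : A → ℝ ≃ₜ ℝ} {x : A}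
    (hα : IsReparametrization A α x) {δ : ℝ} (hd : ∀ t, diam (reparamImage X A α t) < δ)
    (a : A) (t : ℝ) : dist (X t x) (X (α a t) a) < δ := by
  have hx : X t x ∈ reparamImage X A α t := ⟨x, by simp [hα.2.1]⟩
  exact (dist_le_diam_of_mem isBounded_of_compactSpace hx (mem_range_self a)).trans_lt (hd t)

theorem IsSuspension.nExpansive [CompactSpace Y] [CompactSpace M]
    (h : IsSuspension X f) {N : ℕ} (hf : NExpansiveHomeo N f) :
    NExpansive N X := by
  obtain ⟨π, hπ⟩ := h.exists_proj
  obtain ⟨η, hη, hf⟩ := hf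
  intro ε hε
  obtain ⟨δ, hδ, H⟩ := hπ.exists_lift_of_shadowing (half_pos hε) hη
  refine ⟨δ, hδ, ?_⟩
  rintro A α ⟨x, hα⟩ hd
  obtain ⟨⟨y, s⟩, hx⟩ := hπ.surjective x
  have key : ∀ a ∈ A, ∃ (z : Y) (r : ℝ), a = π (z, r) ∧ |s - r| < ε / 2 ∧
      ∀ n : ℤ, dist ((f ^ n) y) ((f ^ n) z) < η := by
    intro a ha
    refine H y s a (α ⟨a, ha⟩) (α ⟨a, ha⟩).continuous (hα.1 _) fun t => ?_
    rw [hx]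
    exact dist_lt_of_diam_reparamImage_lt hα hd ⟨a, ha⟩ t
  have : Nonempty Y := ⟨y⟩
  choose! z r hzr hr hz using key
  -- `B` keeps one point of `A` for each fibre coordinate that occurs. These coordinates lie in the
  -- dynamical ball of `y`, and points sharing one differ by a time less than `ε / 2 + ε / 2`.
  obtain ⟨B, hBA, hB⟩ := exists_subset_bijOn A z
  refine ⟨B, hBA, ?_, fun a ha => ?_⟩
  · rw [← hB.injOn.encard_image, hB.image_eq]
    refine (encard_le_encard ?_).trans (hf y)
    rintro _ ⟨a, ha, rfl⟩
    exact fun n => (hz a ha n).le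
  · obtain ⟨b, hb, hba⟩ := hB.surjOn (mem_image_of_mem z ha)
    refine mem_biUnion hb ?_
    rw [hzr a ha, hzr b (hBA hb), hba]
    apply hπ.mem_orbitSegment
    have h1 := abs_lt.1 (hr a ha)
    have h2 := abs_lt.1 (hr b (hBA hb))
    exact abs_lt.2 ⟨by linarith, by linarith⟩

theorem IsSuspension.cwExpansive [CompactSpace Y] [CompactSpace M]
    (h : IsSuspension X f) (hf : CWExpansiveHomeo f) :
    CWExpansive X := by
  obtain ⟨π, hπ⟩ := h.exists_proj
  obtain ⟨η, hη, hf⟩ := hf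
  intro ε hε
  obtain ⟨δ, hδ, H⟩ := hπ.exists_lift_of_shadowing
    (lt_min hε (by norm_num : (0 : ℝ) < 1 / 4)) (show 0 < η / 3 by positivity)
  refine ⟨δ, hδ, fun A hAc hAconn α x hα hd => ?_⟩
  obtain ⟨⟨y, s⟩, hx⟩ := hπ.surjective x
  have key : ∀ a ∈ A, ∃ (z : Y) (r : ℝ), a = π (z, r) ∧ |s - r| < min ε (1 / 4) ∧
      ∀ n : ℤ, dist ((f ^ n) y) ((f ^ n) z) < η / 3 := by
    intro a ha
    refine H y s a (α ⟨a, ha⟩) (α ⟨a, ha⟩).continuous (hα.1 _) fun t => ?_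
    rw [hx]
    exact dist_lt_of_diam_reparamImage_lt hα hd ⟨a, ha⟩ t
  set I := Icc (s - 1 / 4) (s + 1 / 4)
  have hI : ∀ r, |s - r| ≤ 1 / 4 ↔ r ∈ I := fun r => by
    rw [abs_le, mem_Icc]
    constructor <;> rintro ⟨h1, h2⟩ <;> constructor <;> linarith
  have hIc : CompactSpace I := isCompact_iff_compactSpace.1 isCompact_Icc
  -- The flow box around the time `s` is embedded because its times differ by at most `1 / 2`. It
  -- contains `A`, so `A` lifts to a continuum, whose projection to `Y` is a continuum with small
  -- iterates and therefore a point.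
  set e : Y × I → M := fun p => π (p.1, p.2)
  have he : IsClosedEmbedding e := by
    refine Continuous.isClosedEmbedding (hπ.continuous.comp (by fun_prop)) ?_
    rintro ⟨u, r, hr⟩ ⟨v, r', hr'⟩ huv
    obtain ⟨h1, h2⟩ := hπ.eq_of_eq (abs_lt.2 ⟨by linarith [hr.1, hr'.2],
      by linarith [hr.2, hr'.1]⟩) huv
    simp only [Prod.mk.injEq, Subtype.mk.injEq]
    exact ⟨h1, h2⟩
  have hlift : ∀ p ∈ e ⁻¹' A, |s - p.2| < min ε (1 / 4) ∧
      ∀ n : ℤ, dist ((f ^ n) y) ((f ^ n) p.1) < η / 3 := by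
    rintro ⟨u, r, hr⟩ hp
    obtain ⟨z, r', hzr, hr', hz⟩ := key _ hp
    have hr'I := (hI r').1 (hr'.le.trans (min_le_right _ _))
    rw [show (u, (⟨r, hr⟩ : I)) = (z, ⟨r', hr'I⟩) from he.injective hzr]
    exact ⟨hr', hz⟩
  have hA : e '' (e ⁻¹' A) = A := by
    refine image_preimage_eq_of_subset fun a ha => ?_
    obtain ⟨z, r, rfl, hr, -⟩ := key a ha
    exact ⟨(z, ⟨r, (hI r).1 (hr.le.trans (min_le_right _ _))⟩), rfl⟩
  have hconn : IsConnected (e ⁻¹' A) := by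
    refine ⟨?_, he.isInducing.isPreconnected_image.1 (by
      rw [hA]; exact hAconn.isPreconnected)⟩
    obtain ⟨a, ha⟩ := hAconn.nonempty
    obtain ⟨p, hp, -⟩ := hA.symm ▸ ha
    exact ⟨p, hp⟩
  have hsub : (Prod.fst '' (e ⁻¹' A)).Subsingleton := by
    refine hf _ ((he.isCompact_preimage hAc).image continuous_fst)
      (hconn.image _ continuous_fst.continuousOn) fun n => ?_
    refine (diam_le_of_forall_dist_le (C := 2 * (η / 3)) (by positivity) ?_).trans_lt
      (by linarith)
    rintro _ ⟨_, ⟨p, hp, rfl⟩, rfl⟩ _ ⟨_, ⟨q, hq, rfl⟩, rfl⟩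
    have := dist_triangle_left ((f ^ n) p.1) ((f ^ n) q.1) ((f ^ n) y)
    linarith [(hlift p hp).2 n, (hlift q hq).2 n]
  have hs0 : s ∈ I := (hI s).1 (by simp)
  intro a ha
  obtain ⟨p, hp, rfl⟩ := hA.symm ▸ ha
  have hpy : p.1 = y := by
    refine hsub ⟨p, hp, rfl⟩ ⟨(y, ⟨s, hs0⟩), ?_, rfl⟩
    change π (y, s) ∈ A
    rw [hx]
    exact x.2
  rw [← hx]
  change π (p.1, _) ∈ _
  rw [hpy]
  apply hπ.mem_orbitSegment
  rw [abs_sub_comm]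
  exact (hlift p hp).1.trans_le (min_le_left _ _)

theorem IsSuspension.nExpansiveHomeo [CompactSpace Y]
    (h : IsSuspension X f) {N : ℕ} (hX : NExpansive N X) :
    NExpansiveHomeo N f := by
  obtain ⟨π, hπ⟩ := h.exists_proj
  -- Any `ε ≤ 1` would do: two slice points joined by an orbit segment of length less than 1
  -- coincide.
  obtain ⟨δ, hδ, hX⟩ := hX (1 / 4) (by norm_num)
  obtain ⟨η, hη, H⟩ := hπ.exists_dist_flow_lt (half_pos hδ)
  refine ⟨η / 2, half_pos hη, fun y => ?_⟩
  set W : Set Y := {z | ∀ n : ℤ, dist ((f ^ n) y) ((f ^ n) z) ≤ η / 2}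
  set i : Y → M := fun z => π (z, 0)
  have hi : Function.Injective i := fun u v huv => (hπ.eq_of_eq (by simp) huv).1
  have hy : y ∈ W := fun n => by rw [dist_self]; positivity
  have hrefl : IsReparametrization (i '' W) (fun _ => Homeomorph.refl ℝ) ⟨i y, y, hy, rfl⟩ :=
    ⟨fun _ => rfl, rfl, fun t => continuous_const⟩
  obtain ⟨B, hB, hBN, hAB⟩ := hX (i '' W) _ ⟨_, hrefl⟩ fun t => by
    refine (diam_le_of_forall_dist_le (C := δ / 2) (by positivity) ?_).trans_lt (by linarith)
    rintro _ ⟨⟨_, u, hu, rfl⟩, rfl⟩ _ ⟨⟨_, v, hv, rfl⟩, rfl⟩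
    refine (H u v (fun n => ?_) t).le
    have := dist_triangle_left ((f ^ n) u) ((f ^ n) v) ((f ^ n) y)
    linarith [hu n, hv n]
  rw [← hi.encard_image]
  refine (encard_le_encard fun a ha => ?_).trans hBN
  obtain ⟨b, hb, t, ht, hta⟩ := mem_iUnion₂.1 (hAB ha)
  obtain ⟨u, -, rfl⟩ := ha
  obtain ⟨v, -, rfl⟩ := hB hb
  have huv : π (v, 0 + t) = π (u, 0) := (hπ.flow t v 0).symm.trans hta
  obtain ⟨rfl, -⟩ := hπ.eq_of_eq
    (by rw [zero_add, sub_zero]; exact abs_lt.2 ⟨by linarith [ht.1], by linarith [ht.2]⟩) huv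
  exact hb

theorem IsSuspension.expansiveHomeo [CompactSpace Y]
    (h : IsSuspension X f) (hX : Expansive X) :
    ExpansiveHomeo f := by
  obtain ⟨π, hπ⟩ := h.exists_proj
  obtain ⟨δ, hδ, hX⟩ := hX (1 / 4) (by norm_num)
  obtain ⟨η, hη, H⟩ := hπ.exists_dist_flow_lt hδ
  refine ⟨η, hη, fun y z hyz => ?_⟩
  obtain ⟨t, ht, hty⟩ := hX (π (y, 0)) (π (z, 0)) id continuous_id rfl (H y z hyz)
  have huv : π (y, 0 + t) = π (z, 0) := (hπ.flow t y 0).symm.trans hty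
  exact (hπ.eq_of_eq
    (by rw [zero_add, sub_zero]; exact abs_lt.2 ⟨by linarith [ht.1], by linarith [ht.2]⟩) huv).1

theorem ExpansiveHomeo.nExpansiveHomeo (hf : ExpansiveHomeo f) {N : ℕ} (hN : 1 ≤ N) :
    NExpansiveHomeo N f := by
  obtain ⟨δ, hδ, hf⟩ := hf
  refine ⟨δ, hδ, fun x => ?_⟩
  refine (encard_le_one_iff.2 fun y z hy hz => ?_).trans (by exact_mod_cast hN)
  exact (hf x y hy).symm.trans (hf x z hz)

end Transfer

end CWFlow

namespace CWFlow

/-! ### Adding finitely many parallel copies of invariant sets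

Given a homeomorphism `g` of `Z` and pairwise disjoint closed invariant sets `O k`, we glue to `Z`
finitely many copies of each `O k`, at distance at most `1 / (k + 1)` from the original. -/

section Tower

variable {Z : Type*}

/-- The height at which the `j`-th copy of the `k`-th invariant set lies. -/
noncomputable def towerHeight (k j : ℕ) : ℝ := 1 / (k + 1) * (1 - 1 / (j + 1))

@[simp]
theorem towerHeight_zero (k : ℕ) : towerHeight k 0 = 0 := by simp [towerHeight]

theorem towerHeight_nonneg (k j : ℕ) : 0 ≤ towerHeight k j := by
  have : (1 : ℝ) / (j + 1) ≤ 1 := (div_le_one₀ (by positivity)).2 (by simp)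
  exact mul_nonneg (by positivity) (by linarith)

theorem towerHeight_le (k j : ℕ) : towerHeight k j ≤ 1 / (k + 1) := by
  have : (0 : ℝ) ≤ 1 / (j + 1) := by positivity
  exact mul_le_of_le_one_right (by positivity) (by linarith)

theorem towerHeight_injective (k : ℕ) : Function.Injective (towerHeight k) := by
  intro i j hij
  have hk : (1 : ℝ) / (k + 1) ≠ 0 := by positivity
  have := mul_left_cancel₀ hk hij
  have h2 : (1 : ℝ) / (i + 1) = 1 / (j + 1) := by linarith
  rw [one_div, one_div, inv_inj] at h2
  exact_mod_cast add_right_cancel h2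

/-- The space `Z` together with `c k` further copies of `O k` for every `k`. -/
def tower (O : ℕ → Set Z) (c : ℕ → ℕ) : Set (Z × ℝ) :=
  {p | p.2 = 0 ∨ ∃ k, p.1 ∈ O k ∧ ∃ j ≤ c k, p.2 = towerHeight k j}

variable {O : ℕ → Set Z} {c : ℕ → ℕ}

/-- The copies of level at least `K` lie in the slab of heights in `[0, 1 / (K + 1)]`, and only
finitely many closed pieces lie below level `K`. A point outside every piece lies in all the slabs,
so its height is 0. -/
theorem isClosed_tower [TopologicalSpace Z] (hO : ∀ k, IsClosed (O k)) :
    IsClosed (tower O c) := by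
  have key : tower O c = ⋂ K : ℕ, ({p : Z × ℝ | 0 ≤ p.2 ∧ p.2 ≤ 1 / ((K : ℝ) + 1)} ∪
      ⋃ k ∈ Iio K, O k ×ˢ (towerHeight k '' Iic (c k))) := by
    ext ⟨z, h⟩
    simp only [mem_iInter]
    constructor
    · rintro (h0 | ⟨k, hz, j, hj, hh⟩) K
      · simp only at h0
        subst h0
        exact .inl ⟨le_rfl, by dsimp only; positivity⟩
      · simp only at hz hh
        subst hh
        rcases lt_or_ge k K with hk | hk
        · exact .inr (mem_biUnion (mem_Iio.2 hk) ⟨hz, mem_image_of_mem _ (mem_Iic.2 hj)⟩)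
        · exact .inl ⟨towerHeight_nonneg _ _,
            (towerHeight_le k j).trans (Nat.one_div_le_one_div hk)⟩
    · intro H
      by_contra hn
      have hsmall : ∀ K : ℕ, 0 ≤ h ∧ h ≤ 1 / ((K : ℝ) + 1) := by
        intro K
        rcases H K with hK | hK
        · exact hK
        · obtain ⟨k, -, hz, j, hj, hh⟩ := mem_iUnion₂.1 hK
          exact absurd (.inr ⟨k, hz, j, hj, hh.symm⟩) hn
      have h0 : h ≠ 0 := fun h0 => hn (.inl h0)
      obtain ⟨K, hK⟩ := exists_nat_one_div_lt ((hsmall 0).1.lt_of_ne' h0)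
      exact absurd (hsmall K).2 (not_le.2 hK)
  rw [key]
  refine isClosed_iInter fun K => IsClosed.union ?_ ?_
  · exact (isClosed_le continuous_const continuous_snd).inter
      (isClosed_le continuous_snd continuous_const)
  · exact (finite_Iio K).isClosed_biUnion fun k _ =>
      (hO k).prod ((finite_Iic (c k)).image _).isClosed

theorem isCompact_tower [TopologicalSpace Z] [CompactSpace Z] (hO : ∀ k, IsClosed (O k)) :
    IsCompact (tower O c) := by
  refine ((isCompact_univ (X := Z)).prod (isCompact_Icc (a := (0 : ℝ)) (b := 1))).of_isClosed_subset
    (isClosed_tower hO) ?_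
  rintro ⟨z, h⟩ (h0 | ⟨k, -, j, -, hh⟩)
  · simp only at h0
    subst h0
    exact ⟨mem_univ _, le_rfl, zero_le_one⟩
  · simp only at hh
    subst hh
    exact ⟨mem_univ _, towerHeight_nonneg _ _,
      (towerHeight_le k j).trans ((div_le_one₀ (by positivity)).2 (by simp))⟩

/-- The homeomorphism induced by `g` on the tower. -/
def towerHomeo [TopologicalSpace Z] (g : Z ≃ₜ Z) (O : ℕ → Set Z) (c : ℕ → ℕ)
    (hg : ∀ k z, g z ∈ O k ↔ z ∈ O k) : tower O c ≃ₜ tower O c :=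
  (g.prodCongr (Homeomorph.refl ℝ)).subtype fun p => by simp [tower, hg]

theorem coe_towerHomeo_zpow [TopologicalSpace Z] (g : Z ≃ₜ Z)
    (hg : ∀ k z, g z ∈ O k ↔ z ∈ O k) (n : ℤ) (p : tower O c) :
    (((towerHomeo g O c hg ^ n) p : tower O c) : Z × ℝ) = ((g ^ n) p.1.1, p.1.2) := by
  set F := towerHomeo g O c hg
  have h1 : ∀ p : tower O c, ((F p : tower O c) : Z × ℝ) = (g p.1.1, p.1.2) := fun _ => rfl
  have h2 : ∀ p : tower O c, ((F⁻¹ p : tower O c) : Z × ℝ) = (g⁻¹ p.1.1, p.1.2) := fun _ => rfl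
  induction n generalizing p with
  | zero => simp
  | succ n ih => rw [zpow_add_one, zpow_add_one, Homeomorph.mul_apply, ih, h1]; rfl
  | pred n ih => rw [zpow_sub_one, zpow_sub_one, Homeomorph.mul_apply, ih, h2]; rfl

theorem exists_encard_tower_fiber_le (hdisj : Pairwise (Function.onFun Disjoint O)) (z : Z) :
    ∃ k, {p : tower O c | p.1.1 = z}.encard ≤ (c k + 1 : ℕ) := by
  have hinj : InjOn (fun p : tower O c => p.1.2) {p | p.1.1 = z} := by
    rintro ⟨⟨a, h⟩, hp⟩ (ha : a = z) ⟨⟨b, h'⟩, hq⟩ (hb : b = z) (hh : h = h')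
    subst ha hb hh
    rfl
  rw [← hinj.encard_image]
  by_cases hz : ∃ k, z ∈ O k
  · obtain ⟨k, hk⟩ := hz
    refine ⟨k, (encard_le_encard (t := towerHeight k '' Iic (c k)) ?_).trans ?_⟩
    · rintro _ ⟨⟨⟨a, h⟩, h0 | ⟨k', hk', j, hj, hh⟩⟩, ha, rfl⟩
      -- The original space is the copy `j = 0`, so it adds nothing to the `c k + 1` heights.
      · exact ⟨0, mem_Iic.2 (Nat.zero_le _), by simpa using h0.symm⟩
      · obtain rfl : a = z := ha
        obtain rfl : k = k' := by_contra fun hne => disjoint_left.1 (hdisj hne) hk hk'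
        exact ⟨j, hj, hh.symm⟩
    · refine (encard_image_le _ _).trans ?_
      rw [← Finset.coe_Iic, encard_coe_eq_coe_finsetCard, Nat.card_Iic]
  -- Outside all `O k` the fibre is a single point, so any level serves.
  · refine ⟨0, (encard_le_encard (t := {0}) ?_).trans ?_⟩
    · rintro _ ⟨⟨⟨a, h⟩, h0 | ⟨k', hk', _⟩⟩, ha, rfl⟩
      · exact h0
      · obtain rfl : a = z := ha
        exact absurd ⟨k', hk'⟩ hz
    · rw [encard_singleton]
      exact_mod_cast Nat.le_add_left 1 _

variable [MetricSpace Z] {g : Z ≃ₜ Z} {hg : ∀ k z, g z ∈ O k ↔ z ∈ O k}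

theorem dist_towerHomeo_zpow (n : ℤ) (p q : tower O c) :
    dist ((towerHomeo g O c hg ^ n) p) ((towerHomeo g O c hg ^ n) q) =
      max (dist ((g ^ n) p.1.1) ((g ^ n) q.1.1)) (dist p.1.2 q.1.2) := by
  rw [Subtype.dist_eq, coe_towerHomeo_zpow, coe_towerHomeo_zpow, Prod.dist_eq]

theorem dist_zpow_fst_le (n : ℤ) (p q : tower O c) :
    dist ((g ^ n) p.1.1) ((g ^ n) q.1.1) ≤
      dist ((towerHomeo g O c hg ^ n) p) ((towerHomeo g O c hg ^ n) q) := by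
  rw [dist_towerHomeo_zpow]
  exact le_max_left _ _

/-- Projection to `Z` does not increase distances along orbits, so a dynamical ball at the
expansivity constant of `g` lies in one fibre. -/
theorem nExpansiveHomeo_towerHomeo (hdisj : Pairwise (Function.onFun Disjoint O))
    (hge : ExpansiveHomeo g) {N : ℕ} (hc : ∀ k, c k ≤ N) :
    NExpansiveHomeo (N + 1) (towerHomeo g O c hg) := by
  obtain ⟨δ, hδ, hge⟩ := hge
  refine ⟨δ, hδ, fun p => ?_⟩
  obtain ⟨k, hk⟩ := exists_encard_tower_fiber_le (c := c) hdisj p.1.1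
  refine (encard_le_encard fun q hq => ?_).trans
    (hk.trans (by exact_mod_cast Nat.add_le_add_right (hc k) 1))
  exact (hge _ _ fun n => (dist_zpow_fst_le n p q).trans (hq n)).symm

/-- A continuum with small iterates lies in one fibre. Fibres are finite, hence totally
disconnected; no uniform bound on `c` is needed. -/
theorem cwExpansiveHomeo_towerHomeo [CompactSpace Z] (hO : ∀ k, IsClosed (O k))
    (hdisj : Pairwise (Function.onFun Disjoint O)) (hge : ExpansiveHomeo g) :
    CWExpansiveHomeo (towerHomeo g O c hg) := by
  obtain ⟨δ, hδ, hge⟩ := hge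
  have : CompactSpace (tower O c) := isCompact_iff_compactSpace.1 (isCompact_tower hO)
  refine ⟨δ, hδ, fun A _ hA hd => ?_⟩
  obtain ⟨p, hp⟩ := hA.nonempty
  have hfib : A ⊆ {q | q.1.1 = p.1.1} := by
    intro q hq
    refine (hge _ _ fun n => (dist_zpow_fst_le (hg := hg) n p q).trans ?_).symm
    exact ((dist_le_diam_of_mem
      isBounded_of_compactSpace (mem_image_of_mem _ hp) (mem_image_of_mem _ hq)).trans (hd n).le)
  obtain ⟨k, hk⟩ := exists_encard_tower_fiber_le (c := c) hdisj p.1.1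
  exact (finite_of_encard_le_coe hk).countable.isTotallyDisconnected _ hfib hA.isPreconnected

/-- Points of one fibre keep their distance along orbits, so the `c k + 1 > N` points over some `z ∈
O k` lie in a dynamical ball of radius `1 / (k + 1)`, which is arbitrarily small. -/
theorem not_nExpansiveHomeo_towerHomeo {N : ℕ}
    (hN : ∀ K, ∃ k ≥ K, (O k).Nonempty ∧ N ≤ c k) :
    ¬ NExpansiveHomeo N (towerHomeo g O c hg) := by
  rintro ⟨δ, hδ, H⟩
  obtain ⟨K, hK⟩ := exists_nat_one_div_lt hδ
  obtain ⟨k, hk, ⟨z, hz⟩, hck⟩ := hN K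
  set i : Iic (c k) → tower O c := fun j => ⟨(z, towerHeight k j), .inr ⟨k, hz, j, j.2, rfl⟩⟩
  have hi : Function.Injective i := fun a b hab =>
    Subtype.ext (towerHeight_injective k (congrArg (fun p : tower O c => p.1.2) hab))
  have hle := (encard_le_encard (s := range i) ?_).trans (H (i ⟨0, mem_Iic.2 (Nat.zero_le _)⟩))
  · rw [← image_univ, hi.encard_image, encard_univ, ENat.card_eq_coe_fintype_card] at hle
    have : Fintype.card (Iic (c k)) = c k + 1 := by simp
    rw [this] at hle
    have : c k + 1 ≤ N := by exact_mod_cast hle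
    omega
  · rintro _ ⟨j, rfl⟩ n
    rw [dist_towerHomeo_zpow, dist_self, max_eq_right dist_nonneg, Real.dist_eq]
    simp only [i, towerHeight_zero, zero_sub, abs_neg]
    rw [abs_of_nonneg (towerHeight_nonneg _ _)]
    exact (towerHeight_le k j).trans ((Nat.one_div_le_one_div hk).trans hK.le)

end Tower

end CWFlow

namespace CWFlow

/-! ### The dyadic solenoid -/

section DyadicSolenoid

/-- The dyadic solenoid, the inverse limit of the doubling map of the circle. -/
def solenoid : Set (ℤ → UnitAddCircle) := {x | ∀ n, x (n + 1) = 2 • x n}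

theorem isClosed_solenoid : IsClosed solenoid := by
  have : solenoid = ⋂ n, {x : ℤ → UnitAddCircle | x (n + 1) = 2 • x n} := by
    ext
    simp [solenoid]
  rw [this]
  exact isClosed_iInter fun n => isClosed_eq (by fun_prop) (by fun_prop)

/-- The dyadic solenoid as a type. -/
def Solenoid : Type := solenoid

namespace Solenoid

noncomputable instance : TopologicalSpace Solenoid :=
  inferInstanceAs (TopologicalSpace solenoid)

instance : TopologicalSpace.MetrizableSpace Solenoid :=
  (IsEmbedding.subtypeVal (p := (· ∈ solenoid))).metrizableSpace

instance : CompactSpace Solenoid :=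
  isCompact_iff_compactSpace.1 isClosed_solenoid.isCompact

noncomputable instance : MetricSpace Solenoid := TopologicalSpace.metrizableSpaceMetric Solenoid

theorem continuous_coord (n : ℤ) : Continuous fun x : Solenoid => x.1 n :=
  (continuous_apply n).comp continuous_subtype_val

/-- The shift homeomorphism of the solenoid; on each coordinate it acts as the doubling map. -/
noncomputable def shift : Solenoid ≃ₜ Solenoid where
  toFun x := ⟨fun n => x.1 (n + 1), fun n => x.2 (n + 1)⟩
  invFun x := ⟨fun n => x.1 (n - 1), fun n => by
    have := x.2 (n - 1)
    rwa [← add_sub_right_comm] at this⟩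
  left_inv x := Subtype.ext (funext fun n => by simp)
  right_inv x := Subtype.ext (funext fun n => by simp)
  continuous_toFun := Continuous.subtype_mk (continuous_pi fun n => continuous_coord (n + 1)) _
  continuous_invFun := Continuous.subtype_mk (continuous_pi fun n => continuous_coord (n - 1)) _

theorem shift_zpow_apply (n : ℤ) (x : Solenoid) (m : ℤ) :
    ((shift ^ n) x).1 m = x.1 (m + n) := by
  have h1 : ∀ (x : Solenoid) m, (shift x).1 m = x.1 (m + 1) := fun _ _ => rfl
  have h2 : ∀ (x : Solenoid) m, (shift⁻¹ x).1 m = x.1 (m - 1) := fun _ _ => rfl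
  induction n generalizing x with
  | zero => simp
  | succ n ih =>
    rw [zpow_add_one, Homeomorph.mul_apply, ih, h1, add_assoc]
  | pred n ih =>
    rw [zpow_sub_one, Homeomorph.mul_apply, ih, h2, add_sub_assoc]

/-- The representative in `[-1/4, 1/4]` doubles into `[-1/2, 1/2]`, where the circle norm is still
the absolute value. -/
theorem norm_two_nsmul_of_norm_le {u : UnitAddCircle} (hu : ‖u‖ ≤ 1 / 4) :
    ‖2 • u‖ = 2 * ‖u‖ := by
  obtain ⟨r, hr, rfl⟩ : ∃ r : ℝ, |r| ≤ 1 / 2 ∧ (r : UnitAddCircle) = u := by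
    obtain ⟨r, rfl⟩ := QuotientAddGroup.mk_surjective u
    refine ⟨r - round r, abs_sub_round r, ?_⟩
    rw [AddCircle.coe_sub, sub_eq_self, AddCircle.coe_eq_zero_iff]
    exact ⟨round r, by simp⟩
  have hr' := (AddCircle.norm_coe_eq_abs_iff (1 : ℝ) (x := r) one_ne_zero).2 (by simpa using hr)
  rw [hr'] at hu ⊢
  have h2 : |2 * r| = 2 * |r| := by rw [abs_mul, abs_two]
  rw [← h2, ← AddCircle.coe_nsmul, nsmul_eq_mul, Nat.cast_ofNat,
    (AddCircle.norm_coe_eq_abs_iff (1 : ℝ) one_ne_zero)]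
  rw [h2, abs_one]
  linarith

theorem eq_zero_of_norm_two_pow_nsmul_le {u : UnitAddCircle}
    (hu : ∀ n : ℕ, ‖2 ^ n • u‖ ≤ 1 / 4) : u = 0 := by
  have hpow : ∀ n : ℕ, ‖2 ^ n • u‖ = 2 ^ n * ‖u‖ := by
    intro n
    induction n with
    | zero => simp
    | succ n ih => rw [pow_succ', mul_smul, norm_two_nsmul_of_norm_le (hu n), ih]; ring
  by_contra hne
  obtain ⟨n, hn⟩ := pow_unbounded_of_one_lt (1 / ‖u‖) (one_lt_two (α := ℝ))
  rw [div_lt_iff₀ (norm_pos_iff.2 hne), ← hpow] at hn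
  linarith [hu n]

theorem coord_add_natCast (x : Solenoid) (m : ℤ) (n : ℕ) : x.1 (m + n) = 2 ^ n • x.1 m := by
  induction n with
  | zero => simp
  | succ n ih => rw [Nat.cast_succ, ← add_assoc, x.2, ih, pow_succ', mul_smul]

/-- Coordinate 0 of the iterates `m + n` sees `2 ^ n` times the difference of the `m`-th
coordinates. A nonzero difference would double until it exceeds `1 / 4`. -/
theorem expansiveHomeo_shift : ExpansiveHomeo shift := by
  obtain ⟨δ, hδ, H⟩ := Metric.uniformContinuous_iff.1
    (CompactSpace.uniformContinuous_of_continuous (continuous_coord 0)) (1 / 4) (by norm_num)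
  refine ⟨δ / 2, half_pos hδ, fun x y hxy => Subtype.ext (funext fun m => ?_)⟩
  refine sub_eq_zero.1 (eq_zero_of_norm_two_pow_nsmul_le fun n => ?_)
  have := H ((hxy (m + n)).trans_lt (half_lt_self hδ))
  rw [shift_zpow_apply, shift_zpow_apply, zero_add, coord_add_natCast, coord_add_natCast,
    dist_eq_norm, ← smul_sub] at this
  exact this.le

/-- The points of the solenoid all of whose coordinates have additive order `k + 1`. -/
def torsion (k : ℕ) : Set Solenoid := {x | ∀ n, addOrderOf (x.1 n) = k + 1}

theorem shift_mem_torsion_iff (k : ℕ) (x : Solenoid) : shift x ∈ torsion k ↔ x ∈ torsion k := by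
  refine ⟨fun h n => ?_, fun h n => h (n + 1)⟩
  have := h (n - 1)
  rwa [show (shift x).1 (n - 1) = x.1 (n - 1 + 1) from rfl, sub_add_cancel] at this

theorem isClosed_torsion (k : ℕ) : IsClosed (torsion k) := by
  have : torsion k = ⋂ n : ℤ, (fun x : Solenoid => x.1 n) ⁻¹' {u | addOrderOf u = k + 1} := by
    ext
    simp [torsion]
  rw [this]
  exact isClosed_iInter fun n =>
    (AddCircle.finite_setOfPred_addOrderOf_eq 1 k.succ_pos).isClosed.preimage (continuous_coord n)

theorem pairwise_disjoint_torsion : Pairwise (Function.onFun Disjoint torsion) := by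
  intro k l hkl
  refine disjoint_left.2 fun x hk hl => hkl ?_
  have := (hk 0).symm.trans (hl 0)
  omega

theorem nonempty_torsion {p : ℕ} (hp : p.Prime) (h2 : 2 < p) : (torsion (p - 1)).Nonempty := by
  have : Fact p.Prime := ⟨hp⟩
  have hunit : (2 : ZMod p) ≠ 0 := by
    intro h
    have := (ZMod.natCast_eq_zero_iff 2 p).1 (by exact_mod_cast h)
    exact absurd (Nat.le_of_dvd two_pos this) (not_le.2 h2)
  -- As 2 is a unit modulo the odd prime `p`, the two-sided sequence of its powers is a doubling
  -- orbit; its terms are nonzero, so all have order `p`.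
  refine ⟨⟨fun n => ZMod.toAddCircle ((2 : ZMod p) ^ n), fun n => ?_⟩, fun n => ?_⟩
  · dsimp only
    rw [← map_nsmul, zpow_add_one₀ hunit, nsmul_eq_mul, Nat.cast_ofNat, mul_comm]
  · rw [Nat.sub_add_cancel hp.one_le]
    refine addOrderOf_eq_prime ?_ fun h => ?_
    · rw [← map_nsmul, nsmul_eq_mul, CharP.cast_eq_zero, zero_mul, map_zero]
    · rw [← map_zero (ZMod.toAddCircle (N := p))] at h
      exact zpow_ne_zero n hunit (ZMod.toAddCircle_injective p h)

theorem exists_nonempty_torsion (K : ℕ) : ∃ k ≥ K, (torsion k).Nonempty := by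
  obtain ⟨p, hp, hpp⟩ := Nat.exists_infinite_primes (K + 3)
  exact ⟨p - 1, by omega, nonempty_torsion hpp (by omega)⟩

/-- The homeomorphism induced by the shift on the solenoid with `c k` copies of each set
`torsion k` added. -/
noncomputable def towerShift (c : ℕ → ℕ) : tower torsion c ≃ₜ tower torsion c :=
  towerHomeo shift torsion c shift_mem_torsion_iff

instance (c : ℕ → ℕ) : CompactSpace (tower torsion c) :=
  isCompact_iff_compactSpace.1 (isCompact_tower isClosed_torsion)

theorem nExpansiveHomeo_towerShift (N : ℕ) :
    NExpansiveHomeo (N + 1) (towerShift fun _ => N) :=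
  nExpansiveHomeo_towerHomeo pairwise_disjoint_torsion expansiveHomeo_shift fun _ => le_rfl

theorem not_nExpansiveHomeo_towerShift (N : ℕ) :
    ¬ NExpansiveHomeo N (towerShift fun _ => N) := by
  refine not_nExpansiveHomeo_towerHomeo fun K => ?_
  obtain ⟨k, hk, hne⟩ := exists_nonempty_torsion K
  exact ⟨k, hk, hne, le_rfl⟩

theorem cwExpansiveHomeo_towerShift (c : ℕ → ℕ) : CWExpansiveHomeo (towerShift c) :=
  cwExpansiveHomeo_towerHomeo isClosed_torsion pairwise_disjoint_torsion expansiveHomeo_shift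

theorem not_nExpansiveHomeo_towerShift_id (N : ℕ) : ¬ NExpansiveHomeo N (towerShift id) := by
  refine not_nExpansiveHomeo_towerHomeo fun K => ?_
  -- The bound `k ≥ N` supplies the `N` extra copies, since here `c k = k`.
  obtain ⟨k, hk, hne⟩ := exists_nonempty_torsion (max K N)
  exact ⟨k, (le_max_left _ _).trans hk, hne, (le_max_right _ _).trans hk⟩

end Solenoid

end DyadicSolenoid

end CWFlow

/-! ### The three suspensions -/

theorem theoremB :
    (∃ (Y : Type) (_ : MetricSpace Y) (_ : CompactSpace Y) (f : Y ≃ₜ Y)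
        (M : Type) (_ : MetricSpace M) (_ : CompactSpace M) (X : Flow ℝ M),
        CWFlow.IsSuspension X f ∧
        (CWFlow.CWExpansiveHomeo f ∧ ∀ N : ℕ, 1 ≤ N → ¬ CWFlow.NExpansiveHomeo N f) ∧
        (CWFlow.CWExpansive X ∧ ∀ N : ℕ, 1 ≤ N → ¬ CWFlow.NExpansive N X)) ∧
    ∀ N : ℕ, 2 ≤ N →
      (∃ (Y : Type) (_ : MetricSpace Y) (_ : CompactSpace Y) (f : Y ≃ₜ Y)
          (M : Type) (_ : MetricSpace M) (_ : CompactSpace M) (X : Flow ℝ M),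
          CWFlow.IsSuspension X f ∧
          (CWFlow.NExpansiveHomeo N f ∧ ¬ CWFlow.ExpansiveHomeo f) ∧
          (CWFlow.NExpansive N X ∧ ¬ CWFlow.Expansive X)) ∧
      (∃ (Z : Type) (_ : MetricSpace Z) (_ : CompactSpace Z) (g : Z ≃ₜ Z)
          (L : Type) (_ : MetricSpace L) (_ : CompactSpace L) (Y : Flow ℝ L),
          CWFlow.IsSuspension Y g ∧
          (CWFlow.NExpansiveHomeo (N + 1) g ∧ ¬ CWFlow.NExpansiveHomeo N g) ∧
          (CWFlow.NExpansive (N + 1) Y ∧ ¬ CWFlow.NExpansive N Y)) := by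
  refine ⟨?_, fun N hN => ⟨?_, ?_⟩⟩
  · obtain ⟨M, m, hM, X, hX⟩ := CWFlow.exists_isSuspension (CWFlow.Solenoid.towerShift id)
    exact ⟨_, inferInstance, inferInstance, _, M, m, hM, X, hX,
      ⟨CWFlow.Solenoid.cwExpansiveHomeo_towerShift _,
        fun N _ => CWFlow.Solenoid.not_nExpansiveHomeo_towerShift_id N⟩,
      hX.cwExpansive (CWFlow.Solenoid.cwExpansiveHomeo_towerShift _),
      fun N _ h => CWFlow.Solenoid.not_nExpansiveHomeo_towerShift_id N (hX.nExpansiveHomeo h)⟩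
  -- With `n` extra copies the map is `(n + 1)`- but not `n`-expansive. Since `N ≥ 2` gives `n ≥ 1`,
  -- an expansive map would be `n`-expansive.
  · obtain ⟨n, rfl⟩ : ∃ n, N = n + 1 := ⟨N - 1, by omega⟩
    obtain ⟨M, m, hM, X, hX⟩ :=
      CWFlow.exists_isSuspension (CWFlow.Solenoid.towerShift fun _ => n)
    have hexp : ¬ CWFlow.ExpansiveHomeo (CWFlow.Solenoid.towerShift fun _ => n) := fun h =>
      CWFlow.Solenoid.not_nExpansiveHomeo_towerShift n (h.nExpansiveHomeo (by omega))
    exact ⟨_, inferInstance, inferInstance, _, M, m, hM, X, hX,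
      ⟨CWFlow.Solenoid.nExpansiveHomeo_towerShift n, hexp⟩,
      hX.nExpansive (CWFlow.Solenoid.nExpansiveHomeo_towerShift n),
      fun h => hexp (hX.expansiveHomeo h)⟩
  · obtain ⟨M, m, hM, X, hX⟩ :=
      CWFlow.exists_isSuspension (CWFlow.Solenoid.towerShift fun _ => N)
    exact ⟨_, inferInstance, inferInstance, _, M, m, hM, X, hX,
      ⟨CWFlow.Solenoid.nExpansiveHomeo_towerShift N,
        CWFlow.Solenoid.not_nExpansiveHomeo_towerShift N⟩,
      hX.nExpansive (CWFlow.Solenoid.nExpansiveHomeo_towerShift N),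
      fun h => CWFlow.Solenoid.not_nExpansiveHomeo_towerShift N (hX.nExpansiveHomeo h)⟩
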